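/- Let $(R,\mathfrak m)$ be a complete regular local ring of prime characteristic $p$ and dimension $d$, let $f(r)=r^p$ be its Frobenius map, and let $x_1,\dots,x_d$ be minimal generators of $\mathfrak m$. For an $R$-module $M$ let ${}^f\!M$ be the abelian group $M$ with the $R$-module structure $r\cdot a=r^pa$; with the original multiplication it is a module over the ring ${}^f\!R=R$, and $\mathrm{Hom}_R({}^f\!R,M)$ is an ${}^f\!R$-module via $(s\cdot h)(a)=h(sa)$. Let $E=E_R(R/\mathfrak m)$ be the injective hull of the residue field, realized as the module of inverse polynomials in $x_1,\dots,x_d$, that is, as the quotient of $R_{x_1\cdots x_d}$ by the sum of the images of the $R_{\prod_{j\ne i}x_j}$, $1\le i\le d$. Let $T:E\to E$ be its natural Frobenius map, $T(\lambda x_1^{-\alpha_1}\cdots x_d^{-\alpha_d})=\lambda^p x_1^{-p\alpha_1}\cdots x_d^{-p\alpha_d}$, and let $T$ act on $E^n$ coordinatewise. The skew polynomial ring $R[\Theta;f]$ is the free $R$-module $\bigoplus_{i\ge 0}R\Theta^i$ with multiplication $\Theta r=r^p\Theta$. Fix an isomorphism of ${}^f\!R$-modules $$\mathrm{Hom}_R({}^f\!R,E)\;\cong\;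 G\oplus H,\qquad G=\bigoplus_{\gamma\in\Gamma}{}^f\!E,\qquad H=\bigoplus_{\lambda\in\Lambda}{}^f\!E(R/P_\lambda),$$ with non-maximal prime ideals $P_\lambda$ of $R$, where $E(R/P_\lambda)$ is an injective hull of $R/P_\lambda$. To $\varphi\in\mathrm{Hom}_R({}^f\!R,R)$ associate the element of $\mathcal B=\mathrm{Hom}_R(E,G)$ which is the composition of $E\to\mathrm{Hom}_R({}^f\!R,E)$, $a\mapsto(s\mapsto\varphi(s)a)$, with the projection to $G$. Let $B\in\mathrm{Hom}_R({}^f\!R^n,R^n)$, with entries $B_{ij}\in\mathrm{Hom}_R({}^f\!R,R)$ (so $B_{ij}(s)$ is the $i$-th coordinate of $B(se_j)$), be represented by $(B_\gamma T)_{\gamma\in\Gamma}$, where the $B_\gamma$ are $n\times n$ matrices over $R$: for all $i,j$ the element of $\mathcal B$ associated with $B_{ij}$ has $\gamma$-component $a\mapsto (B_\gamma)_{ij}\,T(a)$ for every $\gamma\in\Gamma$. For each $\gamma\in\Gamma$ regard $E^n$ as an $R[\Theta_\gamma;f]$-module with $\Theta_\gamma v=B_\gamma^{t}\,T v$. Let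 $V$ be an $R$-submodule of $R^n$ and let $A$ be an $n\times m$ matrix over $R$ whose columns generate $V$. If $B({}^fV)\subseteq V$, then $\mathrm{Ann}_{E^n}A^t=\{v\in E^n : A^tv=0\}$ is an $R[\Theta_\gamma;f]$-submodule of $E^n$ for every $\gamma\in\Gamma$. -/

import Mathlib

open IsLocalRing
open scoped DirectSum

universe u

noncomputable section

namespace NearSplitting

/-! ### The twisted module `ᶠM` -/

/-- `Twist p M` is the module `ᶠM`: the additive group `M`, on which `r : R` acts by
multiplication by `r ^ p`. -/
def Twist (_p : ℕ) (M : Type u) : Type u := M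

/-- The identity map, seen as a map `M → ᶠM`. -/
def Twist.of (p : ℕ) {M : Type u} : M ≃ Twist p M := Equiv.refl M

instance (p : ℕ) (M : Type u) [AddCommGroup M] : AddCommGroup (Twist p M) :=
  inferInstanceAs (AddCommGroup M)

/-- As a ring, `ᶠR` is `R` itself. -/
instance (p : ℕ) (R : Type u) [CommRing R] : CommRing (Twist p R) :=
  inferInstanceAs (CommRing R)

/-- `ᶠM` is a module over the ring `ᶠR`, by the original multiplication of `R` on `M`. -/
instance Twist.moduleTwist (p : ℕ) (R M : Type u) [CommRing R] [AddCommGroup M] [Module R M] :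
    Module (Twist p R) (Twist p M) :=
  inferInstanceAs (Module R M)

section Twist

variable (p : ℕ) [Fact p.Prime] (R : Type u) [CommRing R] [CharP R p]
variable (M : Type u) [AddCommGroup M] [Module R M]

/-- The `R`-module structure `r · a = r ^ p a` of `ᶠM`. -/
instance Twist.module : Module R (Twist p M) := Module.compHom M (frobenius R p)

variable {R M}

theorem Twist.smul_of (r : R) (a : M) : r • Twist.of p a = Twist.of p (r ^ p • a) := rfl

instance : IsScalarTower R (Twist p R) (Twist p M) where
  smul_assoc r s a := mul_smul (r ^ p) (show R from s) (show M from a)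

/-- Multiplication by an element `s` of `ᶠR`, as an `R`-linear map `ᶠR → ᶠR`. -/
def Twist.mulLeft (s : Twist p R) : Twist p R →ₗ[R] Twist p R where
  toFun a := s * a
  map_add' a b := mul_add s a b
  map_smul' r a := mul_left_comm (show R from s) (r ^ p : R) (show R from a)

/-- `Hom_R(ᶠR, M)` is an `ᶠR`-module via `(s • h) a = h (s a)`. -/
instance : Module (Twist p R) (Twist p R →ₗ[R] M) where
  smul s h := h.comp (Twist.mulLeft p s)
  one_smul h := LinearMap.ext fun a => congrArg h (one_mul a)
  mul_smul s t h := LinearMap.ext fun a =>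
    congrArg h ((congrArg (· * a) (mul_comm s t)).trans (mul_assoc t s a))
  smul_zero _ := rfl
  smul_add _ _ _ := rfl
  add_smul s t h := LinearMap.ext fun a =>
    (congrArg h (add_mul s t a)).trans (h.map_add (s * a) (t * a))
  zero_smul h := LinearMap.ext fun a => (congrArg h (zero_mul a)).trans h.map_zero

theorem Twist.smul_hom_apply (s : Twist p R) (h : Twist p R →ₗ[R] M) (a : Twist p R) :
    (s • h) a = h (s * a) := rfl

instance : IsScalarTower R (Twist p R) (Twist p R →ₗ[R] M) where
  smul_assoc r s h := LinearMap.ext fun a => by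
    have e : (r • s) * a = r • (s * a) := mul_assoc (r ^ p : R) (show R from s) (show R from a)
    change h ((r • s) * a) = r • h (s * a)
    rw [e, h.map_smul]

end Twist

/-! ### Injective hulls -/

/-- `M` is an injective hull of `N`: it is an injective module which contains `N` as an
essential submodule. -/
def IsInjectiveHull (R N M : Type u) [CommRing R] [AddCommGroup N] [Module R N]
    [AddCommGroup M] [Module R M] : Prop :=
  Module.Injective R M ∧ ∃ j : N →ₗ[R] M, Function.Injective j ∧
    ∀ W : Submodule R M, W ⊓ LinearMap.range j = ⊥ → W = ⊥

/-! ### The injective hull of the residue field as the module of inverse polynomials -/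

section InversePolynomials

variable {R : Type u} [CommRing R] {d : ℕ} (x : Fin d → R)

/-- The submodule of the localization of `R` at `x_1 ⋯ x_d` generated by the elements whose
denominator is a power of `∏_{j ≠ i} x_j` for some `i`. -/
def nonNegativePart : Submodule R (Localization.Away (∏ i, x i)) :=
  Submodule.span R {s | ∃ (i : Fin d) (k : ℕ) (r : R),
    s * algebraMap R _ ((∏ j ∈ Finset.univ.erase i, x j) ^ k) = algebraMap R _ r}

/-- The module of inverse polynomials in `x_1, …, x_d` over `R`: it is generated by the inverse
monomials `x_1 ^ (-α_1) ⋯ x_d ^ (-α_d)`, taken modulo those with some `α_i ≤ 0`.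
When `x_1, …, x_d` are minimal generators of the maximal ideal of the regular local ring `R`,
this is the injective hull `E` of the residue field. -/
def InversePolynomials : Type u := Localization.Away (∏ i, x i) ⧸ nonNegativePart x

instance : AddCommGroup (InversePolynomials x) :=
  inferInstanceAs (AddCommGroup (Localization.Away (∏ i, x i) ⧸ nonNegativePart x))

instance : Module R (InversePolynomials x) :=
  inferInstanceAs (Module R (Localization.Away (∏ i, x i) ⧸ nonNegativePart x))

/-- The inverse monomial `x_1 ^ (-α_1) ⋯ x_d ^ (-α_d)`. -/
def inverseMonomial (α : Fin d → ℕ) : InversePolynomials x :=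
  (nonNegativePart x).mkQ (Ring.inverse (algebraMap R _ (∏ i, x i ^ α i)))

variable (p : ℕ) [Fact p.Prime] [CharP R p]

/-- The `p`-th power map of an `R`-algebra. -/
def algebraFrobenius (S : Type u) [CommRing S] [Algebra R S] : S →ₛₗ[frobenius R p] S where
  toFun s := s ^ p
  map_add' s t := by
    rcases subsingleton_or_nontrivial S with h | h
    · exact Subsingleton.elim _ _
    · have : CharP S p := (CharP.charP_iff_prime_eq_zero Fact.out).2 (by
        rw [← map_natCast (algebraMap R S), CharP.cast_eq_zero R p, map_zero])
      exact add_pow_char s t p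
  map_smul' r s := by rw [smul_pow, frobenius_def]

theorem nonNegativePart_le :
    nonNegativePart x ≤ (nonNegativePart x).comap
      (algebraFrobenius p (Localization.Away (∏ i, x i))) := by
  refine Submodule.span_le.2 ?_
  rintro s ⟨i, k, r, h⟩
  refine Submodule.subset_span ⟨i, k * p, r ^ p, ?_⟩
  change s ^ p * _ = _
  rw [pow_mul, map_pow, ← mul_pow, h, map_pow]

/-- The natural Frobenius map `T` of `E`, induced by the `p`-th power map, so that
`T (λ x_1 ^ (-α_1) ⋯ x_d ^ (-α_d)) = λ ^ p x_1 ^ (-p α_1) ⋯ x_d ^ (-p α_d)`. -/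
def naturalFrobenius : InversePolynomials x →ₛₗ[frobenius R p] InversePolynomials x :=
  Submodule.mapQ (nonNegativePart x) (nonNegativePart x)
    (algebraFrobenius p (Localization.Away (∏ i, x i))) (nonNegativePart_le x p)

theorem naturalFrobenius_smul_inverseMonomial (r : R) (α : Fin d → ℕ) :
    naturalFrobenius x p (r • inverseMonomial x α) =
      r ^ p • inverseMonomial x (fun i => p * α i) := by
  rw [LinearMap.map_smulₛₗ, frobenius_def]
  congr 1
  change (nonNegativePart x).mkQ (_ ^ p) = (nonNegativePart x).mkQ _
  rw [Ring.inverse_pow, ← map_pow, ← Finset.prod_pow]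
  simp only [← pow_mul, mul_comm]

end InversePolynomials

/-! ### The skew polynomial ring `R[Θ; f]` and its modules -/

section Skew

variable (p : ℕ) [Fact p.Prime] (R : Type u) [CommRing R] [CharP R p]

/-- The action of the powers of the Frobenius map `f` on `R`. -/
@[reducible] def frobeniusAction : MulSemiringAction (Multiplicative ℕ) R where
  smul k r := (frobenius R p)^[k.toAdd] r
  one_smul _ := rfl
  mul_smul k l r := Function.iterate_add_apply (frobenius R p) k.toAdd l.toAdd r
  smul_zero k := iterate_map_zero (frobenius R p) k.toAdd
  smul_add k r s := iterate_map_add (frobenius R p) k.toAdd r s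
  smul_one k := iterate_map_one (frobenius R p) k.toAdd
  smul_mul k r s := iterate_map_mul (frobenius R p) k.toAdd r s

/-- The skew polynomial ring `R[Θ; f]`: the free `R`-module on the powers of `Θ`, with
multiplication `Θ r = r ^ p Θ`. -/
def FrobeniusSkewPolynomial (_p : ℕ) (R : Type u) [CommRing R] : Type u := SkewPolynomial R

instance : Ring (FrobeniusSkewPolynomial p R) :=
  letI := frobeniusAction p R
  inferInstanceAs (Ring (SkewPolynomial R))

variable {R}

/-- The element `r Θ ^ i` of `R[Θ; f]`. -/
def FrobeniusSkewPolynomial.monomial (i : ℕ) (r : R) : FrobeniusSkewPolynomial p R :=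
  SkewPolynomial.monomial i r

theorem FrobeniusSkewPolynomial.monomial_mul_monomial (i j : ℕ) (r s : R) :
    monomial p i r * monomial p j s = monomial p (i + j) (r * (frobenius R p)^[i] s) := by
  let := frobeniusAction p R
  exact SkewPolynomial.monomial_mul_monomial i j r s

variable {p}
variable {N : Type u} [AddCommGroup N] [Module R N]

/-- The `R`-module `N`, on which `Θ ∈ R[Θ; f]` acts by the given map `Θ`, which is additive and
satisfies `Θ (r v) = r ^ p Θ v`. -/
def SkewModule (_Θ : N →ₛₗ[frobenius R p] N) : Type u := N

/-- The identity map, seen as a map from `N` to the `R[Θ; f]`-module `N`. -/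
def SkewModule.of (Θ : N →ₛₗ[frobenius R p] N) : N ≃ SkewModule Θ := Equiv.refl N

instance (Θ : N →ₛₗ[frobenius R p] N) : AddCommGroup (SkewModule Θ) :=
  inferInstanceAs (AddCommGroup N)

/-- The map `v ↦ r Θ ^ i v`. -/
def skewMonomialEnd (Θ : N →ₛₗ[frobenius R p] N) (i : ℕ) : R →+ AddMonoid.End N where
  toFun r :=
    { toFun := fun v => r • Θ^[i] v
      map_zero' := by rw [iterate_map_zero, smul_zero]
      map_add' := fun v w => by rw [iterate_map_add, smul_add] }
  map_zero' := by ext v; exact zero_smul R _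
  map_add' r s := by ext v; exact add_smul r s _

theorem iterate_smul (Θ : N →ₛₗ[frobenius R p] N) (i : ℕ) (r : R) (v : N) :
    Θ^[i] (r • v) = (frobenius R p)^[i] r • Θ^[i] v := by
  induction i generalizing r v with
  | zero => rfl
  | succ i ih => rw [Function.iterate_succ_apply, Function.iterate_succ_apply,
      Function.iterate_succ_apply, LinearMap.map_smulₛₗ, ih]

/-- The action of a skew polynomial: `∑ r_i Θ ^ i` sends `v` to `∑ r_i Θ ^ i v`. -/
def skewEnd (Θ : N →ₛₗ[frobenius R p] N) (g : FrobeniusSkewPolynomial p R) : AddMonoid.End N :=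
  SkewPolynomial.sum g (fun i r => skewMonomialEnd Θ i r)

theorem skewEnd_add (Θ : N →ₛₗ[frobenius R p] N) (g h : FrobeniusSkewPolynomial p R) :
    skewEnd Θ (g + h) = skewEnd Θ g + skewEnd Θ h :=
  SkewMonoidAlgebra.sum_add_index' (fun _ => map_zero _) (fun _ => map_add _)

theorem skewEnd_monomial (Θ : N →ₛₗ[frobenius R p] N) (i : ℕ) (r : R) :
    skewEnd Θ (FrobeniusSkewPolynomial.monomial p i r) = skewMonomialEnd Θ i r :=
  SkewPolynomial.sum_monomial_index (map_zero _)

theorem skewEnd_monomial_mul (Θ : N →ₛₗ[frobenius R p] N) (i : ℕ) (r : R)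
    (h : FrobeniusSkewPolynomial p R) :
    skewEnd Θ (FrobeniusSkewPolynomial.monomial p i r * h) =
      skewMonomialEnd Θ i r * skewEnd Θ h := by
  refine SkewPolynomial.induction
    (motive := fun h : FrobeniusSkewPolynomial p R =>
      skewEnd Θ (FrobeniusSkewPolynomial.monomial p i r * h) =
        skewMonomialEnd Θ i r * skewEnd Θ h) h ?_ ?_
  · change skewEnd Θ (FrobeniusSkewPolynomial.monomial p i r * 0) = _ * skewEnd Θ 0
    rw [mul_zero]
    exact (mul_zero (skewMonomialEnd Θ i r)).symm
  · intro j s (h : FrobeniusSkewPolynomial p R) _ _ ih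
    change skewEnd Θ (FrobeniusSkewPolynomial.monomial p i r *
      (FrobeniusSkewPolynomial.monomial p j s + h)) =
      _ * skewEnd Θ (FrobeniusSkewPolynomial.monomial p j s + h)
    rw [mul_add, skewEnd_add, skewEnd_add, ih, mul_add,
      FrobeniusSkewPolynomial.monomial_mul_monomial, skewEnd_monomial, skewEnd_monomial]
    congr 1
    ext v
    change (r * (frobenius R p)^[i] s) • Θ^[i + j] v = r • Θ^[i] (s • Θ^[j] v)
    rw [iterate_smul, mul_smul, Function.iterate_add_apply]

theorem skewEnd_mul (Θ : N →ₛₗ[frobenius R p] N) (g h : FrobeniusSkewPolynomial p R) :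
    skewEnd Θ (g * h) = skewEnd Θ g * skewEnd Θ h := by
  refine SkewPolynomial.induction
    (motive := fun g : FrobeniusSkewPolynomial p R =>
      skewEnd Θ (g * h) = skewEnd Θ g * skewEnd Θ h) g ?_ ?_
  · change skewEnd Θ (0 * h) = skewEnd Θ 0 * _
    rw [zero_mul]
    exact (zero_mul (skewEnd Θ h)).symm
  · intro i r (g : FrobeniusSkewPolynomial p R) _ _ ih
    change skewEnd Θ ((FrobeniusSkewPolynomial.monomial p i r + g) * h) =
      skewEnd Θ (FrobeniusSkewPolynomial.monomial p i r + g) * _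
    rw [add_mul, skewEnd_add, skewEnd_add, ih, add_mul, skewEnd_monomial_mul, skewEnd_monomial]

/-- The `R[Θ; f]`-module structure of `N` given by the map `Θ`. -/
instance (Θ : N →ₛₗ[frobenius R p] N) :
    Module (FrobeniusSkewPolynomial p R) (SkewModule Θ) where
  smul g v := skewEnd Θ g v
  one_smul v := by
    have h : skewEnd Θ (1 : FrobeniusSkewPolynomial p R) = skewMonomialEnd Θ 0 1 :=
      skewEnd_monomial Θ 0 1
    change skewEnd Θ 1 v = v
    rw [h]
    exact one_smul R _
  mul_smul g h v := congrArg (fun F : AddMonoid.End N => F v) (skewEnd_mul Θ g h)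
  smul_zero g := map_zero (skewEnd Θ g)
  smul_add g v w := map_add (skewEnd Θ g) v w
  add_smul g h v := congrArg (fun F : AddMonoid.End N => F v) (skewEnd_add Θ g h)
  zero_smul v := rfl

theorem SkewModule.monomial_smul (Θ : N →ₛₗ[frobenius R p] N) (i : ℕ) (r : R) (v : N) :
    FrobeniusSkewPolynomial.monomial p i r • SkewModule.of Θ v =
      SkewModule.of Θ (r • Θ^[i] v) :=
  congrArg (fun F : AddMonoid.End N => F v) (skewEnd_monomial Θ i r)

end Skew

/-! ### Matrices acting on powers of a module -/

section MatrixAction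

variable {R : Type u} [CommRing R] {N : Type u} [AddCommGroup N] [Module R N] {n m : ℕ}

/-- The map `N ^ n → N ^ m`, `v ↦ C v`, of an `m × n` matrix `C` over `R`. -/
def matrixMap (C : Matrix (Fin m) (Fin n) R) : (Fin n → N) →ₗ[R] (Fin m → N) :=
  LinearMap.pi fun k => ∑ i, C k i • LinearMap.proj i

/-- The Frobenius map `v ↦ C T v` of `N ^ n`, where `T` acts on each coordinate. -/
def matrixFrobenius {p : ℕ} [Fact p.Prime] [CharP R p] (C : Matrix (Fin n) (Fin n) R)
    (T : N →ₛₗ[frobenius R p] N) : (Fin n → N) →ₛₗ[frobenius R p] (Fin n → N) :=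
  { toFun := fun v => matrixMap C fun i => T (v i)
    map_add' := fun v w => by
      rw [← map_add]
      exact congrArg (matrixMap C) (funext fun i => T.map_add (v i) (w i))
    map_smul' := fun r v => by
      rw [← map_smul]
      exact congrArg (matrixMap C) (funext fun i => T.map_smulₛₗ r (v i)) }

theorem matrixMap_apply (C : Matrix (Fin m) (Fin n) R) (v : Fin n → N) (k : Fin m) :
    matrixMap C v k = ∑ i, C k i • v i := by
  simp [matrixMap]

end MatrixAction

/-! ### Near-splittings and their representation by Frobenius maps -/

section NearSplittings

variable (p : ℕ) [Fact p.Prime] {R : Type u} [CommRing R] [CharP R p]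

/-- A decomposition of the injective `ᶠR`-module `Hom_R(ᶠR, E)` as
`(⨁_{γ ∈ Γ} ᶠE) ⊕ (⨁_{l ∈ Λ} ᶠE(R/P_l))`, with non-maximal prime ideals `P_l`. -/
structure TwistedDualDecomposition [IsLocalRing R] {d : ℕ} (x : Fin d → R) where
  /-- The index set of the copies of `ᶠE`. -/
  Γ : Type u
  /-- The index set of the other summands. -/
  Λ : Type u
  /-- The prime ideals `P_l`. -/
  P : Λ → Ideal R
  isPrime : ∀ l, (P l).IsPrime
  ne_maximalIdeal : ∀ l, P l ≠ maximalIdeal R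
  /-- The injective hulls `E(R/P_l)`. -/
  hull : Λ → Type u
  [addCommGroup : ∀ l, AddCommGroup (hull l)]
  [module : ∀ l, Module R (hull l)]
  isInjectiveHull : ∀ l, IsInjectiveHull R (R ⧸ P l) (hull l)
  /-- The isomorphism of `ᶠR`-modules. -/
  iso : (Twist p R →ₗ[R] InversePolynomials x) ≃ₗ[Twist p R]
    (⨁ _γ : Γ, Twist p (InversePolynomials x)) × (⨁ l, Twist p (hull l))

attribute [instance] TwistedDualDecomposition.addCommGroup TwistedDualDecomposition.module

variable {p}

/-- The map `Hom_R(ᶠR, R) → Hom_R(E, ⨁_{γ ∈ Γ} ᶠE) = ℬ`: it sends `φ` to the composition of its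
Matlis dual `E → Hom_R(ᶠR, E)`, `a ↦ (s ↦ φ(s) a)`, with the projection of `Hom_R(ᶠR, E)` to
`⨁_{γ ∈ Γ} ᶠE`. -/
def TwistedDualDecomposition.toFrobeniusMaps [IsLocalRing R] {d : ℕ} {x : Fin d → R}
    (D : TwistedDualDecomposition p x) (φ : Twist p R →ₗ[R] R) :
    InversePolynomials x →ₗ[R] ⨁ _γ : D.Γ, Twist p (InversePolynomials x) :=
  (LinearMap.fst R _ _).comp
    ((D.iso.toLinearMap.restrictScalars R).comp (LinearMap.smulRightₗ φ))

variable {n : ℕ}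

/-- The `j`-th coordinate embedding `ᶠR → ᶠ(R ^ n)`. -/
def twistSingle (j : Fin n) : Twist p R →ₗ[R] Twist p (Fin n → R) where
  toFun a := Twist.of p (Pi.single j ((Twist.of p).symm a))
  map_add' a b := Pi.single_add (f := fun _ => R) j a b
  map_smul' r a := Pi.single_smul (f := fun _ : Fin n => R) j (r ^ p) (show R from a)

/-- The `(i, j)` entry, in `Hom_R(ᶠR, R)`, of `B ∈ Hom_R(ᶠR ^ n, R ^ n)`. -/
def entry (B : Twist p (Fin n → R) →ₗ[R] (Fin n → R)) (i j : Fin n) : Twist p R →ₗ[R] R :=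
  (LinearMap.proj i).comp (B.comp (twistSingle j))

/-- `B ∈ Hom_R(ᶠR ^ n, R ^ n)` is represented by `(B_γ T)_{γ ∈ Γ}`: each entry of `B` corresponds
to the family of Frobenius maps of `E` given by the same entry of the matrices `B_γ T`. -/
def IsRepresentedBy [IsLocalRing R] {d : ℕ} {x : Fin d → R} (D : TwistedDualDecomposition p x)
    (B : Twist p (Fin n → R) →ₗ[R] (Fin n → R)) (C : D.Γ → Matrix (Fin n) (Fin n) R) : Prop :=
  ∀ (i j : Fin n) (a : InversePolynomials x) (γ : D.Γ),
    D.toFrobeniusMaps (entry B i j) a γ = Twist.of p (C γ i j • naturalFrobenius x p a)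

end NearSplittings

end NearSplitting

end

open NearSplitting

namespace NearSplitting

/-! ### Submodules stable under `Θ`, as modules over `R[Θ; f]`. -/

section SkewSubmodules

variable {p : ℕ} [Fact p.Prime] {R : Type u} [CommRing R] [CharP R p]
variable {N : Type u} [AddCommGroup N] [Module R N]

/-! An `R`-submodule stable under `Θ` is an `R[Θ; f]`-submodule, so it suffices that `Aᵗ v = 0`
implies `Aᵗ B_γᵗ T v = 0`. For `v = (v_j)` and a column `A_k` of `A`, consider the map `h_k : ᶠR →
E`, `h_k(s) = ∑_j (B(s A_k))_j v_j`. Since `s A_k ∈ V` and `B` maps `ᶠV` into `V`, the vector `B(s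
A_k)` lies in the column space of `A`, which pairs to zero with `v`; hence `h_k = 0`. On the other
hand `h_k = ∑_i A_ik • ∑_j B_ji(·) v_j` for the `ᶠR`-structure of `Hom_R(ᶠR, E)`. The projection to
the `γ`-th copy of `ᶠE` is `ᶠR`-linear and sends `B_ji(·) v_j` to `(B_γ)_ji T v_j`, so it sends
`h_k` to the `k`-th coordinate of `Aᵗ B_γᵗ T v`, which therefore vanishes. The argument is
`IsRepresentedBy.matrixMap_matrixFrobenius_eq_zero`. -/

theorem skewEnd_apply_mem (Θ : N →ₛₗ[frobenius R p] N) (K : Submodule R N)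
    (hK : ∀ v ∈ K, Θ v ∈ K) (g : FrobeniusSkewPolynomial p R) {v : N} (hv : v ∈ K) :
    skewEnd Θ g v ∈ K := by
  refine SkewPolynomial.induction
    (motive := fun g : FrobeniusSkewPolynomial p R => skewEnd Θ g v ∈ K) g ?_ ?_
  · exact K.zero_mem
  · intro i r (g : FrobeniusSkewPolynomial p R) hi _ ih
    change skewEnd Θ (FrobeniusSkewPolynomial.monomial p i r + g) v ∈ K
    rw [skewEnd_add, skewEnd_monomial]
    refine K.add_mem (K.smul_mem r ?_) ih
    clear hi
    induction i with
    | zero => exact hv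
    | succ i ih =>
      rw [Function.iterate_succ_apply']
      exact hK _ ih

/-- An `R`-submodule of `N` which is stable under `Θ`, as an `R[Θ; f]`-submodule. -/
def skewSubmodule (Θ : N →ₛₗ[frobenius R p] N) (K : Submodule R N)
    (hK : ∀ v ∈ K, Θ v ∈ K) : Submodule (FrobeniusSkewPolynomial p R) (SkewModule Θ) where
  carrier := SkewModule.of Θ '' K
  add_mem' := by
    rintro _ _ ⟨v, hv, rfl⟩ ⟨w, hw, rfl⟩
    exact ⟨v + w, K.add_mem hv hw, rfl⟩
  zero_mem' := ⟨0, K.zero_mem, rfl⟩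
  smul_mem' := by
    rintro g _ ⟨v, hv, rfl⟩
    exact ⟨skewEnd Θ g v, skewEnd_apply_mem Θ K hK g hv, rfl⟩

theorem of_mem_skewSubmodule (Θ : N →ₛₗ[frobenius R p] N) (K : Submodule R N)
    (hK : ∀ v ∈ K, Θ v ∈ K) (v : N) : SkewModule.of Θ v ∈ skewSubmodule Θ K hK ↔ v ∈ K :=
  (SkewModule.of Θ).injective.mem_set_image

end SkewSubmodules

/-! ### Entries of a near-splitting and their `γ`-components. -/

section Entries

variable {p : ℕ} [Fact p.Prime] {R : Type u} [CommRing R] [CharP R p] {n m : ℕ}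

/-- Only additivity of `B` is used: a coordinate `w i` need not be a `p`-th power, so it stays
inside the entry as an element of `ᶠR`. -/
theorem apply_eq_sum_entry (B : Twist p (Fin n → R) →ₗ[R] (Fin n → R)) (w : Fin n → R)
    (j : Fin n) : B (Twist.of p w) j = ∑ i, entry B j i (Twist.of p (w i)) := by
  have h : Twist.of p w = ∑ i, twistSingle i (Twist.of p (w i)) :=
    (Finset.univ_sum_single w).symm
  rw [h, map_sum, Finset.sum_apply]
  rfl

/-- The vectors of `N ^ n` killed by `Aᵗ` are killed by every vector in the column space
of `A`. -/
theorem sum_smul_eq_zero_of_mem_span {N : Type u} [AddCommGroup N] [Module R N]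
    (A : Matrix (Fin n) (Fin m) R) {v : Fin n → N} (hv : matrixMap A.transpose v = 0)
    {w : Fin n → R} (hw : w ∈ Submodule.span R (Set.range A.col)) : ∑ i, w i • v i = 0 := by
  induction hw using Submodule.span_induction with
  | mem w hw =>
    obtain ⟨k, rfl⟩ := hw
    have h := congrFun hv k
    rw [matrixMap_apply] at h
    exact h
  | zero => simp
  | add w w' _ _ h h' => simp [add_smul, Finset.sum_add_distrib, h, h']
  | smul r w _ h => simp [mul_smul, ← Finset.smul_sum, h]

variable [IsLocalRing R] {d : ℕ} {x : Fin d → R}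

/-- The component at `γ` of the projection of `Hom_R(ᶠR, E)` to `⨁_{γ ∈ Γ} ᶠE`. -/
def TwistedDualDecomposition.component (D : TwistedDualDecomposition p x) (γ : D.Γ) :
    (Twist p R →ₗ[R] InversePolynomials x) →ₗ[Twist p R] Twist p (InversePolynomials x) :=
  (DirectSum.component (Twist p R) D.Γ (fun _ => Twist p (InversePolynomials x)) γ).comp
    ((LinearMap.fst (Twist p R) _ _).comp D.iso.toLinearMap)

/-- Representability restated through the `ᶠR`-linear `component`, because `toFrobeniusMaps` is
linear over `R` only, and so lets just `p`-th powers through. -/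
theorem IsRepresentedBy.component_smulRight {D : TwistedDualDecomposition p x}
    {B : Twist p (Fin n → R) →ₗ[R] (Fin n → R)} {C : D.Γ → Matrix (Fin n) (Fin n) R}
    (hB : IsRepresentedBy D B C) (γ : D.Γ) (i j : Fin n) (a : InversePolynomials x) :
    D.component γ ((entry B i j).smulRight a) =
      Twist.of p (C γ i j • naturalFrobenius x p a) :=
  hB i j a γ

theorem IsRepresentedBy.matrixMap_matrixFrobenius_eq_zero {D : TwistedDualDecomposition p x}
    {B : Twist p (Fin n → R) →ₗ[R] (Fin n → R)} {C : D.Γ → Matrix (Fin n) (Fin n) R}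
    (hB : IsRepresentedBy D B C) (A : Matrix (Fin n) (Fin m) R)
    (hA : ∀ w ∈ Submodule.span R (Set.range A.col),
      B (Twist.of p w) ∈ Submodule.span R (Set.range A.col)) (γ : D.Γ)
    {v : Fin n → InversePolynomials x} (hv : matrixMap A.transpose v = 0) :
    matrixMap A.transpose (matrixFrobenius (C γ).transpose (naturalFrobenius x p) v) = 0 := by
  funext k
  -- The map `h_k`: here `A i k` acts as an element of `ᶠR`, by precomposition with multiplication.
  have key : ∑ i, Twist.of p (A i k) • ∑ j, (entry B j i).smulRight (v j) = 0 := by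
    refine LinearMap.ext fun s => ?_
    -- The original multiplication by `s`: a submodule contains every multiple of the column, not
    -- only those by `p`-th powers.
    have hs : (show R from s) • A.col k ∈ Submodule.span R (Set.range A.col) :=
      Submodule.smul_mem _ _ (Submodule.subset_span ⟨k, rfl⟩)
    have h := sum_smul_eq_zero_of_mem_span A hv (hA _ hs)
    simp only [apply_eq_sum_entry, Finset.sum_smul] at h
    rw [Finset.sum_comm] at h
    simp only [LinearMap.sum_apply, Twist.smul_hom_apply, LinearMap.smulRight_apply,
      LinearMap.zero_apply]
    rw [← h]
    refine Finset.sum_congr rfl fun i _ => Finset.sum_congr rfl fun j _ => ?_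
    rw [mul_comm]
    rfl
  -- By `ᶠR`-linearity the coefficients `A i k` come out unchanged, with no Frobenius twist.
  have h := congrArg (D.component γ) key
  simp only [map_sum, map_smul, map_zero, hB.component_smulRight] at h
  rw [matrixMap_apply]
  refine Eq.trans (Finset.sum_congr rfl fun i _ => ?_) h
  -- `ᶠE` over `ᶠR` is `E` over `R`, so the two scalar actions agree by definition.
  exact congrArg (A i k • ·) (matrixMap_apply _ _ i)

end Entries

end NearSplitting

theorem mainTheorem6 {p : ℕ} [Fact p.Prime] {R : Type u} [CommRing R] [IsRegularLocalRing R]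
    [IsAdicComplete (maximalIdeal R) R] [CharP R p]
    {d : ℕ} (x : Fin d → R) (hd : (d : WithBot ℕ∞) = ringKrullDim R)
    (hx : Ideal.span (Set.range x) = maximalIdeal R)
    (D : TwistedDualDecomposition p x)
    {n : ℕ} (B : Twist p (Fin n → R) →ₗ[R] (Fin n → R))
    (Bγ : D.Γ → Matrix (Fin n) (Fin n) R) (hB : IsRepresentedBy D B Bγ)
    (V : Submodule R (Fin n → R)) {m : ℕ} (A : Matrix (Fin n) (Fin m) R)
    (hA : Submodule.span R (Set.range A.col) = V)
    (hV : ∀ v ∈ V, B (Twist.of p v) ∈ V) (γ : D.Γ) :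
    ∃ W : Submodule (FrobeniusSkewPolynomial p R)
        (SkewModule (matrixFrobenius (Bγ γ).transpose (naturalFrobenius x p))),
      ∀ v : Fin n → InversePolynomials x,
        SkewModule.of _ v ∈ W ↔ matrixMap A.transpose v = 0 := by
  subst hA
  refine ⟨skewSubmodule _ (LinearMap.ker (matrixMap A.transpose)) fun v hv =>
    hB.matrixMap_matrixFrobenius_eq_zero A hV γ hv, fun v => ?_⟩
  exact of_mem_skewSubmodule _ _ _ v
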